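/- Let $m,k\ge 1$ be integers and let $b(z)=\sum_{n=-m}^{k}b_nz^n$ be a Laurent polynomial with complex coefficients and $b_{-m}b_k\neq 0$. Let $T_b$ be the Toeplitz operator $T_bf=P_+(bf)$ on the Hardy space $H^2(\mathbb T)$, where $P_+$ is the orthogonal projection of $L^2(\mathbb T)$ onto $H^2(\mathbb T)$; denote by $\sigma(T_b)$ and $\rho(T_b)$ its spectrum and its resolvent set. Let $w_0\in\partial\sigma(T_b)$ be a point that does not belong to the set $K=\{b(\lambda):\lambda\in\mathbb C\setminus\{0\},\ b'(\lambda)=0\}$, and let $c>0$. For $\varepsilon>0$ let $\Omega'(w_0,\varepsilon)$ be the set of all $w\in\rho(T_b)$ with $|w-w_0|<\varepsilon$ such that $$\left|\operatorname{Re}\left\{\frac{\overline{\zeta}}{b'(\zeta)}\,(w-w_0)\right\}\right|>c\,|w-w_0|$$ for every $\zeta\in\mathbb C$ with $|\zeta|=1$ and $b(\zeta)=w_0$. Then there is $\varepsilon_0>0$, depending on $b$, $w_0$ and $c$, such that for every $\varepsilon\in(0,\varepsilon_0)$ there is a constant $C>0$, depending on $b$, $w_0$, $c$ and $\varepsilon$,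 with $$\bigl\|(T_b-w)^{-1}\bigr\|\le\frac{C}{\operatorname{dist}(w,\sigma(T_b))}\qquad\text{for all } w\in\Omega'(w_0,\varepsilon).$$ -/

import Mathlib

namespace HardyToeplitz

open MeasureTheory
open scoped ComplexConjugate ENNReal

noncomputable section

/-! The unit circle `𝕋` is the group `UnitAddCircle = ℝ / ℤ`, a class `x` standing for the point
`t = exp (2πix)` of `𝕋`; it carries the normalized Lebesgue measure `AddCircle.haarAddCircle`,
and `fourier n` is the function `t ^ n`. -/

/-- `L²(𝕋)`. -/
abbrev L2 : Type := Lp ℂ 2 (AddCircle.haarAddCircle (T := (1 : ℝ)))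

/-- The Hardy space `H²(𝕋)`: the functions in `L²(𝕋)` that are orthogonal to all `t ^ n`, `n < 0`;
see `mem_H2_iff` for the description by Fourier coefficients. -/
def H2 : Submodule ℂ L2 :=
  (Submodule.span ℂ {f : L2 | ∃ n : ℤ, n < 0 ∧ f = fourierLp 2 n})ᗮ

theorem mem_H2_iff (f : L2) : f ∈ H2 ↔ ∀ n : ℤ, n < 0 → fourierCoeff f n = 0 := by
  have key : ∀ n : ℤ, inner ℂ (fourierLp (T := (1 : ℝ)) 2 n) f = fourierCoeff f n := by
    intro n
    rw [← fourierBasis_repr, HilbertBasis.repr_apply_apply, coe_fourierBasis]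
  constructor
  · intro hf n hn
    rw [← key n]
    exact (Submodule.mem_orthogonal _ _).1 hf _ (Submodule.subset_span ⟨n, hn, rfl⟩)
  · intro h
    rw [H2, Submodule.mem_orthogonal]
    intro u hu
    induction hu using Submodule.span_induction with
    | mem x hx =>
      obtain ⟨n, hn, rfl⟩ := hx
      rw [key n, h n hn]
    | zero => simp
    | add x y _ _ hx hy => rw [inner_add_left, hx, hy, add_zero]
    | smul a x _ hx => rw [inner_smul_left, hx, mul_zero]

instance : CompleteSpace H2 := by
  unfold H2
  infer_instance

/-- Multiplication by `φ ∈ L^∞(𝕋)`, as a bounded operator on `L²(𝕋)`. -/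
def mulOp (φ : Lp ℂ ∞ (AddCircle.haarAddCircle (T := (1 : ℝ)))) : L2 →L[ℂ] L2 :=
  (ContinuousLinearMap.mul ℂ ℂ).holderL AddCircle.haarAddCircle ∞ 2 2 φ

/-- The Toeplitz operator `f ↦ P₊ (φ f)` on `H²(𝕋)` with symbol `φ ∈ L^∞(𝕋)`, where `P₊` is the
orthogonal projection of `L²(𝕋)` onto `H²(𝕋)`. -/
def toeplitz (φ : Lp ℂ ∞ (AddCircle.haarAddCircle (T := (1 : ℝ)))) : H2 →L[ℂ] H2 :=
  H2.orthogonalProjectionOnto ∘L mulOp φ ∘L H2.subtypeL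

/-- The value `b(z) = ∑ₙ bₙ zⁿ` of a Laurent polynomial (meaningful for `z ≠ 0`). -/
def symb (b : LaurentPolynomial ℂ) (z : ℂ) : ℂ :=
  b.coeff.sum fun n c => c * z ^ n

/-- The restriction of `b` to the unit circle. -/
def symbCircle (b : LaurentPolynomial ℂ) : C(UnitAddCircle, ℂ) :=
  b.coeff.sum fun n c => c • fourier n

theorem symbCircle_apply (b : LaurentPolynomial ℂ) (x : UnitAddCircle) :
    symbCircle b x = symb b (AddCircle.toCircle x : ℂ) := by
  simp [symbCircle, symb, Finsupp.sum, ContinuousMap.sum_apply, fourier_apply,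
    AddCircle.toCircle_zsmul]

/-- The Toeplitz operator `T_b` on `H²(𝕋)` whose symbol is the Laurent polynomial `b`. -/
def toeplitzLaurent (b : LaurentPolynomial ℂ) : H2 →L[ℂ] H2 :=
  toeplitz (ContinuousMap.toLp ∞ AddCircle.haarAddCircle ℂ (symbCircle b))

/-- The exceptional set `K = {b(ζ) : ζ ≠ 0, b'(ζ) = 0}`. -/
def criticalValues (b : LaurentPolynomial ℂ) : Set ℂ :=
  {w | ∃ ζ : ℂ, ζ ≠ 0 ∧ deriv (symb b) ζ = 0 ∧ symb b ζ = w}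

/-- The roots of `b(z) = w` on the unit circle. -/
def unimodularRoots (b : LaurentPolynomial ℂ) (w : ℂ) : Set ℂ :=
  {z | ‖z‖ = 1 ∧ symb b z = w}

/-- The open double cone with vertex `w₀` and aperture constant `c` attached to a root `z` of
`b(z) = w₀`. -/
def cone (b : LaurentPolynomial ℂ) (c : ℝ) (w₀ z : ℂ) : Set ℂ :=
  {w | c * ‖w - w₀‖ < |(conj z / deriv (symb b) z * (w - w₀)).re|}

/-- The domain `Ω(w₀, ε) = B(w₀, ε) ∩ ρ(T_b)`. -/
def Ω (b : LaurentPolynomial ℂ) (w₀ : ℂ) (ε : ℝ) : Set ℂ :=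
  Metric.ball w₀ ε ∩ resolventSet ℂ (toeplitzLaurent b)

/-- The non-tangential domain `Ω'(w₀, ε)`: the intersection of `Ω(w₀, ε)` with the cones attached
to all the roots of `b(z) = w₀` on the unit circle. -/
def Ω' (b : LaurentPolynomial ℂ) (c : ℝ) (w₀ : ℂ) (ε : ℝ) : Set ℂ :=
  Ω b w₀ ε ∩ ⋂ z ∈ unimodularRoots b w₀, cone b c w₀ z

end

end HardyToeplitz

namespace HardyToeplitz

open Polynomial

/-! ### Resolvents of an isometry and of its adjoint -/

section CStar

variable {A : Type*} [CStarAlgebra A] {S : A}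

/-! With `S` the unilateral shift, `T_b - w = S*^m p(S)` for the polynomial `p(z) = z^m (b(z) - w)`
of degree `m + k`. For `w` near `w₀` the roots of `p` are simple and uniformly separated, because
`w₀` is not a critical value. If moreover no root is unimodular, invertibility forces exactly `m`
roots into the disc, and `S* S = 1` gives `T_b - w = b_k ∏ (1 - z S*) ∏ (S - ζ)`, with `z` running
over the inner roots and `ζ` over the outer ones (`card_eq_of_isUnit`, `pow_card_mul_aeval_prod`).
Partial fractions then write the inverse as a combination, with bounded coefficients, of products
`(S - ζ)⁻¹ (1 - z S*)⁻¹`.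

If all roots are at distance at least `δ` from the circle, each factor is only `O(1/δ)`, and the
trivial bound on the product is `O(1/δ²)`. The true order is `1/δ`
(`norm_resolvent_mul_coresolvent_le`): in the opposite order a resolvent identity gives `O(1/δ)`,
and the commutator passes through the projection `Q = 1 - S S*`, where each of its two factors costs
only `δ^(-1/2)`.

Finally, the cone condition says that a root near a unimodular `ζ` moves off the circle at a rate
comparable to `|w - w₀|` (`abs_norm_sub_one_ge_of_cone`). So `δ` can be a multiple of `|w - w₀|`,
which is at least `dist(w, σ(T_b))` since `w₀` lies in the spectrum. -/

theorem commutator_of_inverses {R : Type*} [Ring R] {a c F G : R} (hF : F * a = 1) (hF' : a * F = 1)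
    (hG : G * c = 1) (hG' : c * G = 1) : F * G - G * F = G * F * (a * c - c * a) * (F * G) := by
  have h1 : G * F * (a * c) * (F * G) = F * G := by
    rw [mul_assoc G F, ← mul_assoc F a, hF, one_mul, hG, one_mul]
  have h2 : G * F * (c * a) * (F * G) = G * F := by
    rw [mul_assoc (G * F), mul_assoc c, ← mul_assoc a, hF', one_mul, hG', mul_one]
  rw [mul_sub, sub_mul, h1, h2]

theorem norm_one_le_one : ‖(1 : A)‖ ≤ 1 := by
  have h := CStarRing.norm_star_mul_self (x := (1 : A))
  rw [star_one, mul_one] at h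
  nlinarith [norm_nonneg (1 : A)]

theorem norm_le_one_of_star_mul_self (hS : star S * S = 1) : ‖S‖ ≤ 1 := by
  have h := CStarRing.norm_star_mul_self (x := S)
  rw [hS] at h
  nlinarith [norm_nonneg S, norm_one_le_one (A := A)]

theorem star_mul_one_sub (hS : star S * S = 1) : star S * (1 - S * star S) = 0 := by
  rw [mul_sub, mul_one, ← mul_assoc, hS, one_mul, sub_self]

theorem one_sub_mul_isometry (hS : star S * S = 1) : (1 - S * star S) * S = 0 := by
  rw [sub_mul, one_mul, mul_assoc, hS, mul_one, sub_self]

theorem star_one_sub : star (1 - S * star S) = 1 - S * star S := by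
  simp

theorem one_sub_mul_self (hS : star S * S = 1) :
    (1 - S * star S) * (1 - S * star S) = 1 - S * star S := by
  conv_lhs => rw [mul_sub (1 - S * star S) 1 (S * star S), mul_one, ← mul_assoc,
    one_sub_mul_isometry hS, zero_mul, sub_zero]

theorem norm_one_sub_le (hS : star S * S = 1) : ‖1 - S * star S‖ ≤ 1 := by
  have h := CStarRing.norm_star_mul_self (x := 1 - S * star S)
  rw [star_one_sub, one_sub_mul_self hS] at h
  nlinarith [norm_nonneg (1 - S * star S)]

theorem isUnit_one_sub_smul_star (hS : star S * S = 1) {z : ℂ} (hz : ‖z‖ < 1) :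
    IsUnit (1 - z • star S) := by
  refine isUnit_one_sub_of_norm_lt_one ?_
  rw [norm_smul, norm_star]
  nlinarith [norm_le_one_of_star_mul_self hS, norm_nonneg z]

theorem isUnit_sub_algebraMap (hS : star S * S = 1) {ζ : ℂ} (hζ : 1 < ‖ζ‖) :
    IsUnit (S - algebraMap ℂ A ζ) := by
  have h0 : ζ ≠ 0 := by rintro rfl; simp at hζ; linarith
  have h1 : IsUnit (1 - ζ⁻¹ • S) := by
    refine isUnit_one_sub_of_norm_lt_one ?_
    rw [norm_smul, norm_inv]
    have := inv_lt_one_of_one_lt₀ hζ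
    have h2 : 0 ≤ ‖ζ‖⁻¹ := by positivity
    nlinarith [norm_le_one_of_star_mul_self hS]
  have h2 : IsUnit (algebraMap ℂ A (-ζ)) := (IsUnit.mk0 (-ζ) (neg_ne_zero.2 h0)).map _
  have h3 := h2.mul h1
  rw [← Algebra.smul_def, smul_sub, smul_smul, neg_mul, mul_inv_cancel₀ h0, neg_smul, neg_smul,
    one_smul, sub_neg_eq_add, ← Algebra.algebraMap_eq_smul_one, neg_add_eq_sub] at h3
  exact h3

/-- Bound for the resolvent of an isometry outside the closed unit disc. -/
theorem norm_resolvent_le (hS : star S * S = 1) {ζ : ℂ} {F : A}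
    (h : (S - algebraMap ℂ A ζ) * F = 1) : (‖ζ‖ - 1) * ‖F‖ ≤ 1 := by
  have h1 : ζ • F = S * F - 1 := by
    rw [sub_mul, ← Algebra.smul_def] at h
    rw [← h]; abel
  have h2 : ‖ζ‖ * ‖F‖ ≤ ‖F‖ + 1 := by
    rw [← norm_smul, h1]
    refine (norm_sub_le _ _).trans (add_le_add ((norm_mul_le _ _).trans ?_) norm_one_le_one)
    exact mul_le_of_le_one_left (norm_nonneg _) (norm_le_one_of_star_mul_self hS)
  linarith

theorem norm_coresolvent_le (hS : star S * S = 1) {z : ℂ} {G : A}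
    (h : (1 - z • star S) * G = 1) : (1 - ‖z‖) * ‖G‖ ≤ 1 := by
  have h1 : G = 1 + z • (star S * G) := by
    rw [sub_mul, one_mul, smul_mul_assoc] at h
    rw [← h]; abel
  have h2 : ‖G‖ ≤ 1 + ‖z‖ * ‖G‖ := by
    calc ‖G‖ = ‖1 + z • (star S * G)‖ := by rw [← h1]
      _ ≤ 1 + ‖z‖ * ‖G‖ := by
        refine (norm_add_le _ _).trans (add_le_add norm_one_le_one ?_)
        rw [norm_smul]
        refine mul_le_mul_of_nonneg_left ((norm_mul_le _ _).trans ?_) (norm_nonneg _)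
        rw [norm_star]
        exact mul_le_of_le_one_left (norm_nonneg _) (norm_le_one_of_star_mul_self hS)
  linarith

/-- Pythagoras: `G = F Q` satisfies `ζ G = S G - Q`, and the cross terms vanish because `S* Q = 0`,
so `|ζ|² G* G = G* G + Q`. Compressing by `Q` thus improves the order of the resolvent bound from
`δ⁻¹` to `δ^(-1/2)`. -/
theorem norm_resolvent_mul_le (hS : star S * S = 1) {ζ : ℂ} {F : A}
    (h : (S - algebraMap ℂ A ζ) * F = 1) :
    (‖ζ‖ ^ 2 - 1) * ‖F * (1 - S * star S)‖ ^ 2 ≤ 1 := by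
  have hRQ := star_mul_one_sub hS
  have hQS := one_sub_mul_isometry hS
  have hQQ := one_sub_mul_self hS
  have hQs := star_one_sub (S := S)
  have hQn := norm_one_sub_le hS
  generalize 1 - S * star S = Q at *
  set G := F * Q with hG
  have h1 : ζ • G = S * G - Q := by
    have : (S - algebraMap ℂ A ζ) * G = Q := by rw [hG, ← mul_assoc, h, one_mul]
    rw [sub_mul, ← Algebra.smul_def] at this
    rw [← this]; abel
  have h2 : star (ζ • G) * (ζ • G) = star G * G + Q := by
    rw [h1, star_sub, star_mul, hQs, sub_mul, mul_sub, mul_sub, mul_assoc,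
      ← mul_assoc (star S), hS, one_mul, mul_assoc, hRQ, mul_zero, sub_zero,
      ← mul_assoc Q, hQS, zero_mul, hQQ]
    abel
  have h3 : ‖ζ • G‖ * ‖ζ • G‖ ≤ ‖G‖ * ‖G‖ + 1 := by
    rw [← CStarRing.norm_star_mul_self, h2, ← CStarRing.norm_star_mul_self]
    exact (norm_add_le _ _).trans (add_le_add le_rfl hQn)
  rw [norm_smul] at h3
  nlinarith

/-- The dual computation: `E = Q G` satisfies `E = Q + z E S*`, and `S* Q = 0` leaves `E E* = Q +
|z|² E E*`. -/
theorem norm_mul_coresolvent_le (hS : star S * S = 1) {z : ℂ} {G : A}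
    (h : G * (1 - z • star S) = 1) :
    (1 - ‖z‖ ^ 2) * ‖(1 - S * star S) * G‖ ^ 2 ≤ 1 := by
  have hRQ := star_mul_one_sub hS
  have hQS := one_sub_mul_isometry hS
  have hQQ := one_sub_mul_self hS
  have hQs := star_one_sub (S := S)
  have hQn := norm_one_sub_le hS
  generalize 1 - S * star S = Q at *
  set E := Q * G with hE
  have h1 : E = Q + z • (E * star S) := by
    have : E * (1 - z • star S) = Q := by rw [hE, mul_assoc, h, mul_one]
    rw [mul_sub, mul_one, mul_smul_comm] at this
    rw [← this]; abel
  have h2 : E * star E = Q + (z * star z) • (E * star E) := by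
    conv_lhs => rw [h1]
    have hSQ : (E * star S) * Q = 0 := by rw [mul_assoc, hRQ, mul_zero]
    have hQE : Q * (S * star E) = 0 := by
      rw [← mul_assoc, hQS, zero_mul]
    rw [star_add, star_smul, star_mul, star_star, hQs, add_mul, mul_add, mul_add,
      hQQ, mul_smul_comm, hQE, smul_mul_assoc, hSQ, smul_mul_smul_comm,
      mul_assoc E, ← mul_assoc (star S), hS, one_mul]
    simp
  have h3 : ‖E‖ * ‖E‖ ≤ 1 + ‖z‖ ^ 2 * (‖E‖ * ‖E‖) := by
    have h4 : ‖E * star E‖ = ‖E‖ * ‖E‖ := CStarRing.norm_self_mul_star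
    rw [← h4]
    conv_lhs => rw [h2]
    refine (norm_add_le _ _).trans (add_le_add hQn ?_)
    rw [norm_smul, norm_mul, norm_star, sq]
  nlinarith

/-- The product of a resolvent of an isometry and a resolvent of its adjoint at distinct points
at distance at least `δ` from the unit circle has norm of order `δ⁻¹` only. -/
theorem norm_resolvent_mul_coresolvent_le (hS : star S * S = 1) {z ζ : ℂ} {δ η : ℝ} (hδ : 0 < δ)
    (hδ1 : δ ≤ 1) (hη : 0 < η) (hz : ‖z‖ ≤ 1 - δ) (hζ : 1 + δ ≤ ‖ζ‖) (hd : η ≤ ‖ζ - z‖) {F G : A}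
    (hF : F * (S - algebraMap ℂ A ζ) = 1) (hF' : (S - algebraMap ℂ A ζ) * F = 1)
    (hG : G * (1 - z • star S) = 1) (hG' : (1 - z • star S) * G = 1) :
    ‖F * G‖ ≤ 4 / (η * δ) := by
  set Q := 1 - S * star S with hQ
  have hζ0 : ζ ≠ 0 := by rintro rfl; simp at hζ; linarith
  have hne : ζ - z ≠ 0 := by rw [← norm_pos_iff]; linarith
  -- Resolvent identity for the favourable order, from `(1 - z S*) S = (S - ζ) + (ζ - z)`.
  have hGF : (ζ - z) • (G * F) = S * F - G := by
    have h1 : (1 - z • star S) * S = (S - algebraMap ℂ A ζ) + algebraMap ℂ A (ζ - z) := by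
      rw [sub_mul, smul_mul_assoc, hS, map_sub, one_mul, Algebra.algebraMap_eq_smul_one z]
      abel
    have h2 : S = G * (S - algebraMap ℂ A ζ) + (ζ - z) • G := by
      rw [Algebra.smul_def, Algebra.commutes, ← mul_add, ← h1, ← mul_assoc, hG, one_mul]
    conv_rhs => rw [h2, add_mul, mul_assoc, hF', mul_one, smul_mul_assoc]
    abel
  have hGQ : G * Q = Q := by
    have h1 : (1 - z • star S) * Q = Q := by
      rw [sub_mul, one_mul, smul_mul_assoc, star_mul_one_sub hS, smul_zero, sub_zero]
    nth_rw 1 [← h1]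
    rw [← mul_assoc, hG, one_mul]
  have hQF : ζ • (Q * F) = -Q := by
    have h1 : Q * (S - algebraMap ℂ A ζ) = -(ζ • Q) := by
      rw [mul_sub, one_sub_mul_isometry hS, zero_sub, ← Algebra.commutes, Algebra.smul_def]
    have h2 : Q = -(ζ • (Q * F)) := by
      rw [← smul_mul_assoc, ← neg_mul, ← h1, mul_assoc, hF', mul_one]
    rw [eq_neg_iff_add_eq_zero]
    nth_rw 2 [h2]
    abel
  -- The commutator of `S - ζ` and `1 - z S*` is `z Q`. In the resulting `G F Q F G`, the relation
  -- `Q F = -ζ⁻¹ Q` removes the second `F`, and `Q = Q²` puts a projection next to each remaining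
  -- factor.
  have hcomm : ζ • (F * G) = ζ • (G * F) - z • ((G * F * Q) * (Q * G)) := by
    have h1 : F * G - G * F = z • ((G * F * Q) * (F * G)) := by
      have h3 : (S - algebraMap ℂ A ζ) * (1 - z • star S) - (1 - z • star S) *
          (S - algebraMap ℂ A ζ) = z • Q := by
        rw [hQ]
        simp only [mul_sub, sub_mul, mul_one, one_mul, smul_mul_assoc, mul_smul_comm, hS,
          ← Algebra.commutes ζ (star S), smul_sub]
        abel
      rw [commutator_of_inverses hF hF' hG hG', h3]
      simp only [mul_smul_comm, smul_mul_assoc, mul_assoc]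
    have h2 : ζ • ((G * F * Q) * (F * G)) = -((G * F * Q) * (Q * G)) := by
      rw [mul_assoc (G * F), ← mul_assoc Q F, ← mul_smul_comm, ← smul_mul_assoc, hQF, neg_mul,
        mul_neg, mul_assoc (G * F), ← mul_assoc Q Q, one_sub_mul_self hS]
    have h4 : ζ • (F * G) - ζ • (G * F) = z • (ζ • ((G * F * Q) * (F * G))) := by
      rw [← smul_sub, h1, smul_comm]
    rw [h2, smul_neg] at h4
    rw [sub_eq_add_neg, ← h4]; abel
  have hSn := norm_le_one_of_star_mul_self hS
  have nF : δ * ‖F‖ ≤ 1 :=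
    (mul_le_mul_of_nonneg_right (by linarith) (norm_nonneg _)).trans (norm_resolvent_le hS hF')
  have nG : δ * ‖G‖ ≤ 1 :=
    (mul_le_mul_of_nonneg_right (by linarith) (norm_nonneg _)).trans (norm_coresolvent_le hS hG')
  have nFQ : δ * ‖F * Q‖ ^ 2 ≤ 1 :=
    (mul_le_mul_of_nonneg_right (by nlinarith) (sq_nonneg _)).trans
      (norm_resolvent_mul_le hS hF')
  have nQG : δ * ‖Q * G‖ ^ 2 ≤ 1 :=
    (mul_le_mul_of_nonneg_right (by nlinarith [norm_nonneg z]) (sq_nonneg _)).trans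
      (norm_mul_coresolvent_le hS hG)
  have nGF : η * δ * ‖G * F‖ ≤ 2 := by
    have h1 : ‖ζ - z‖ * ‖G * F‖ ≤ ‖F‖ + ‖G‖ := by
      rw [← norm_smul, hGF]
      refine (norm_sub_le _ _).trans (add_le_add ((norm_mul_le _ _).trans ?_) le_rfl)
      exact mul_le_of_le_one_left (norm_nonneg _) hSn
    have h2 : η * ‖G * F‖ ≤ ‖F‖ + ‖G‖ :=
      (mul_le_mul_of_nonneg_right hd (norm_nonneg _)).trans h1
    nlinarith
  have nGFQ : η * ‖G * F * Q‖ ≤ ‖F * Q‖ + 1 := by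
    refine (mul_le_mul_of_nonneg_right hd (norm_nonneg _)).trans ?_
    rw [← norm_smul, ← smul_mul_assoc, hGF, sub_mul, hGQ, mul_assoc]
    refine (norm_sub_le _ _).trans (add_le_add ((norm_mul_le _ _).trans ?_) (norm_one_sub_le hS))
    exact mul_le_of_le_one_left (norm_nonneg _) hSn
  have nFG : ‖F * G‖ ≤ ‖G * F‖ + ‖G * F * Q‖ * ‖Q * G‖ := by
    have h1 : ‖ζ‖ * ‖F * G‖ ≤ ‖ζ‖ * ‖G * F‖ + ‖z‖ * (‖G * F * Q‖ * ‖Q * G‖) := by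
      rw [← norm_smul, hcomm, ← norm_smul]
      refine (norm_sub_le _ _).trans (add_le_add le_rfl ?_)
      rw [norm_smul]
      exact mul_le_mul_of_nonneg_left (norm_mul_le _ _) (norm_nonneg _)
    have h2 : ‖z‖ * (‖G * F * Q‖ * ‖Q * G‖) ≤ ‖ζ‖ * (‖G * F * Q‖ * ‖Q * G‖) :=
      mul_le_mul_of_nonneg_right (by linarith) (by positivity)
    have h3 : 0 < ‖ζ‖ := norm_pos_iff.2 hζ0
    refine le_of_mul_le_mul_left ?_ h3
    linarith
  rw [le_div_iff₀ (by positivity)]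
  have k1 : η * (‖G * F * Q‖ * ‖Q * G‖) ≤ (‖F * Q‖ + 1) * ‖Q * G‖ := by
    rw [← mul_assoc]; exact mul_le_mul_of_nonneg_right nGFQ (norm_nonneg _)
  -- With `x = ‖F Q‖` and `y = ‖Q G‖`, both of square at most `1/δ`: `x y ≤ (x² + y²)/2` and `y ≤ (1
  -- + y²)/2`, with `δ ≤ 1`.
  have k2 : δ * ((‖F * Q‖ + 1) * ‖Q * G‖) ≤ 2 := by
    nlinarith [sq_nonneg (‖F * Q‖ - ‖Q * G‖), sq_nonneg (‖Q * G‖ - 1)]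
  have k3 : δ * (η * (‖G * F * Q‖ * ‖Q * G‖)) ≤ 2 :=
    (mul_le_mul_of_nonneg_left k1 hδ.le).trans k2
  nlinarith [mul_le_mul_of_nonneg_left nFG (mul_pos hη hδ).le]

end CStar

end HardyToeplitz

namespace HardyToeplitz

open Polynomial

/-! ### Partial fractions through Lagrange interpolation -/

section PartialFractions

/-- Only right inverses are needed: polynomials in `T` commute, so the factor `p i` can be moved
next to `F i`, and what remains is the given partition of unity evaluated at `T`. -/
theorem aeval_prod_mul_sum {A ι : Type*} [Ring A] [Algebra ℂ A] [DecidableEq ι] (T : A)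
    (s : Finset ι) (p : ι → ℂ[X]) (c : ι → ℂ) (F : ι → A)
    (h : ∑ i ∈ s, C (c i) * ∏ j ∈ s.erase i, p j = 1) (hF : ∀ i ∈ s, aeval T (p i) * F i = 1) :
    aeval T (∏ i ∈ s, p i) * ∑ i ∈ s, c i • F i = 1 := by
  rw [Finset.mul_sum, ← map_one (aeval (R := ℂ) T), ← h, map_sum]
  refine Finset.sum_congr rfl fun i hi => ?_
  rw [← Finset.prod_erase_mul _ _ hi, map_mul, mul_smul_comm, mul_assoc, hF i hi, mul_one, map_mul,
    aeval_C, ← Algebra.smul_def]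

theorem sum_prod_X_sub_C (s : Finset ℂ) (hs : s.Nonempty) :
    ∑ i ∈ s, C (∏ j ∈ s.erase i, (i - j)⁻¹) * ∏ j ∈ s.erase i, (X - C j) = 1 := by
  refine (Finset.sum_congr rfl fun i _ => ?_).trans
    (Lagrange.sum_basis (v := id) Function.injective_id.injOn hs)
  simp only [Lagrange.basis, Lagrange.basisDivisor, Finset.prod_mul_distrib, map_prod, id]

/-- Since `1 - j X = -j (X - j⁻¹)`, this is again the Lagrange partition of unity, now with the
inverses as nodes. -/
theorem sum_prod_one_sub (s : Finset ℂ) (hs : s.Nonempty) (h0 : 0 ∉ s) :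
    ∑ i ∈ s, C (∏ j ∈ s.erase i, (i * (i - j)⁻¹)) * ∏ j ∈ s.erase i, (1 - C j * X) = 1 := by
  refine (Finset.sum_congr rfl fun i hi => ?_).trans
    (Lagrange.sum_basis (v := fun z : ℂ => z⁻¹) inv_injective.injOn hs)
  rw [Lagrange.basis, map_prod, ← Finset.prod_mul_distrib]
  refine Finset.prod_congr rfl fun j hj => ?_
  have hi0 : i ≠ 0 := fun h => h0 (h ▸ hi)
  have hj0 : j ≠ 0 := fun h => h0 (h ▸ Finset.mem_of_mem_erase hj)
  have hij : i - j ≠ 0 := sub_ne_zero.2 (Finset.ne_of_mem_erase hj).symm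
  have e1 : (i⁻¹ - j⁻¹)⁻¹ = -(i * (i - j)⁻¹) * j := by
    rw [inv_sub_inv hi0 hj0, inv_div, ← neg_sub i j]
    field_simp
  have e2 : (C j * C j⁻¹ : ℂ[X]) = 1 := by rw [← C_mul, mul_inv_cancel₀ hj0, C_1]
  simp only [Lagrange.basisDivisor]
  rw [e1, C_mul (a := -(i * (i - j)⁻¹)), C_neg, mul_assoc, mul_sub (C j), e2]
  ring

theorem norm_prod_erase_le {s : Finset ℂ} {η : ℝ} (hη : 0 < η) (hη1 : η ≤ 1) {i : ℂ}
    {f : ℂ → ℂ} (hf : ∀ j ∈ s.erase i, ‖f j‖ ≤ η⁻¹) {N : ℕ} (hN : s.card ≤ N) :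
    ‖∏ j ∈ s.erase i, f j‖ ≤ η⁻¹ ^ N := by
  rw [norm_prod]
  calc ∏ j ∈ s.erase i, ‖f j‖ ≤ ∏ _j ∈ s.erase i, η⁻¹ :=
        Finset.prod_le_prod (fun _ _ => norm_nonneg _) hf
    _ = η⁻¹ ^ (s.erase i).card := by rw [Finset.prod_const]
    _ ≤ η⁻¹ ^ N := pow_le_pow_right₀ ((one_le_inv₀ hη).2 hη1)
        ((Finset.card_le_card (Finset.erase_subset _ _)).trans hN)

end PartialFractions

/-! ### Factorization and the count of inner roots -/

section Factorization

variable {A : Type*} [Ring A] [Algebra ℂ A] {S R : A}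

theorem aeval_one_sub (R : A) (z : ℂ) : aeval R (1 - C z * X : ℂ[X]) = 1 - z • R := by
  simp [Algebra.smul_def]

/-- Each factor absorbs one `R`, by `R (S - z) = 1 - z R`; the result commutes with the remaining
powers of `R`. -/
theorem pow_card_mul_aeval_prod (hRS : R * S = 1) (t : Finset ℂ) :
    R ^ t.card * aeval S (∏ z ∈ t, (X - C z)) = aeval R (∏ z ∈ t, (1 - C z * X)) := by
  induction t using Finset.induction_on with
  | empty => simp
  | insert z t hz ih =>
    have h1 : R * aeval S (X - C z : ℂ[X]) = 1 - z • R := by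
      rw [map_sub, aeval_X, aeval_C, mul_sub, hRS, ← Algebra.commutes, Algebra.smul_def]
    have h2 : R ^ t.card * (1 - z • R) = (1 - z • R) * R ^ t.card := by
      rw [mul_sub, sub_mul, mul_one, one_mul, mul_smul_comm, smul_mul_assoc, ← pow_succ, pow_succ']
    rw [Finset.card_insert_of_notMem hz, Finset.prod_insert hz, Finset.prod_insert hz, map_mul,
      map_mul, aeval_one_sub, ← ih, pow_succ, mul_assoc, ← mul_assoc R, h1, ← mul_assoc, h2,
      mul_assoc]

theorem isUnit_aeval_prod {ι : Type*} (T : A) (s : Finset ι) (p : ι → ℂ[X])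
    (h : ∀ i ∈ s, IsUnit (aeval T (p i))) : IsUnit (aeval T (∏ i ∈ s, p i)) := by
  have := Submonoid.prod_mem ((IsUnit.submonoid A).comap (aeval T : ℂ[X] →ₐ[ℂ] A)) (t := s) (f := p)
    fun i hi => h i hi
  exact this

theorem isUnit_mid {M : Type*} [Monoid M] {u x v : M} (hu : IsUnit u) (hv : IsUnit v)
    (h : IsUnit (u * x * v)) : IsUnit x := by
  obtain ⟨u, rfl⟩ := hu
  obtain ⟨v, rfl⟩ := hv
  rwa [Units.isUnit_mul_units, Units.isUnit_units_mul] at h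

/-- The number of roots in the disc of an invertible Toeplitz operator is the order of its pole. -/
theorem card_eq_of_isUnit (hRS : R * S = 1) (hR : ¬ IsUnit R) {m : ℕ} {t t' : Finset ℂ}
    (ht : ∀ z ∈ t, IsUnit (1 - z • R)) (ht' : ∀ z ∈ t', IsUnit (S - algebraMap ℂ A z))
    (h : IsUnit (R ^ m * aeval S ((∏ z ∈ t, (X - C z)) * ∏ z ∈ t', (X - C z)))) : t.card = m := by
  have hV : IsUnit (aeval S (∏ z ∈ t', (X - C z))) :=
    isUnit_aeval_prod S t' _ fun z hz => by simpa using ht' z hz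
  have hU : ∀ t₁ ⊆ t, IsUnit (aeval R (∏ z ∈ t₁, (1 - C z * X))) := fun t₁ h₁ =>
    isUnit_aeval_prod R t₁ _ fun z hz => by rw [aeval_one_sub]; exact ht z (h₁ hz)
  rw [map_mul] at h
  -- With too few inner roots a positive power of `R` is left over and would be a unit. With too
  -- many, some `S - z` is left over; were it a unit, `R (S - z) = 1 - z R` would make `R` one too.
  rcases lt_trichotomy t.card m with hlt | heq | hgt
  · exfalso
    obtain ⟨d, rfl⟩ := Nat.exists_eq_add_of_lt hlt
    rw [show t.card + d + 1 = (d + 1) + t.card by ring, pow_add, mul_assoc, ← mul_assoc (R ^ t.card),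
      pow_card_mul_aeval_prod hRS, ← mul_assoc, ← one_mul (R ^ (d + 1)), mul_assoc 1] at h
    rw [← mul_assoc] at h
    have h2 := isUnit_mid isUnit_one ((hU t subset_rfl).mul hV) (by simpa [mul_assoc] using h)
    exact hR ((isUnit_pow_iff d.succ_ne_zero).1 h2)
  · exact heq
  · exfalso
    obtain ⟨t₁, h₁, hc⟩ := Finset.exists_subset_card_eq hgt.le
    rw [← Finset.prod_sdiff h₁, mul_comm (∏ z ∈ t \ t₁, _), map_mul, ← mul_assoc, ← mul_assoc,
      ← hc, pow_card_mul_aeval_prod hRS] at h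
    have h2 := isUnit_mid (hU t₁ h₁) hV h
    have hne : (t \ t₁).Nonempty := by
      rw [← Finset.card_pos, Finset.card_sdiff_of_subset h₁]; omega
    obtain ⟨z, hz⟩ := hne
    rw [← Finset.mul_prod_erase _ _ hz, map_mul] at h2
    have h3 := ((Commute.all (X - C z) _).map (aeval S : ℂ[X] →ₐ[ℂ] A)).isUnit_mul_iff.1 h2
    have h4 : R * aeval S (X - C z : ℂ[X]) = 1 - z • R := by
      rw [map_sub, aeval_X, aeval_C, mul_sub, hRS, ← Algebra.commutes, Algebra.smul_def]
    obtain ⟨u, hu⟩ := h3.1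
    have h5 := ht z (Finset.sdiff_subset hz)
    rw [← h4, ← hu, Units.isUnit_mul_units] at h5
    exact hR h5

end Factorization

/-- Resolvent bound for Toeplitz operators with Laurent polynomial symbols, in terms of the distance
of the roots from each other and from the unit circle. -/
theorem norm_inverse_le {A : Type*} [CStarAlgebra A] {S : A} (hS : star S * S = 1)
    (hR : ¬ IsUnit (star S)) {m : ℕ} {a : ℂ} (ha : a ≠ 0) {s : Finset ℂ} (hm : 1 ≤ m)
    (hms : m < s.card) (h0 : 0 ∉ s) {δ η : ℝ} (hδ : 0 < δ) (hδ1 : δ ≤ 1) (hη : 0 < η) (hη1 : η ≤ 1)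
    (hs : ∀ z ∈ s, δ ≤ |‖z‖ - 1|) (hd : ∀ z ∈ s, ∀ y ∈ s, z ≠ y → η ≤ ‖z - y‖)
    (hT : IsUnit (star S ^ m * aeval S (C a * ∏ z ∈ s, (X - C z)))) :
    ‖Ring.inverse (star S ^ m * aeval S (C a * ∏ z ∈ s, (X - C z)))‖ ≤
      ‖a‖⁻¹ * (s.card ^ 2 * (η⁻¹ ^ s.card) ^ 2 * (4 / (η * δ))) := by
  classical
  set t := s.filter (fun z => ‖z‖ < 1) with ht
  set t' := s.filter (fun z => ¬ ‖z‖ < 1) with ht'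
  have hts : t ⊆ s := Finset.filter_subset _ _
  have hts' : t' ⊆ s := Finset.filter_subset _ _
  have tin : ∀ z ∈ t, ‖z‖ ≤ 1 - δ := fun z hz => by
    have h1 := hs z (hts hz)
    have h2 := (Finset.mem_filter.1 hz).2
    rw [abs_of_neg (by linarith)] at h1; linarith
  have tout : ∀ z ∈ t', 1 + δ ≤ ‖z‖ := fun z hz => by
    have h1 := hs z (hts' hz)
    have h2 := (Finset.mem_filter.1 hz).2
    rw [abs_of_nonneg (by linarith)] at h1; linarith
  have uin : ∀ z ∈ t, IsUnit (1 - z • star S) := fun z hz =>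
    isUnit_one_sub_smul_star hS (by linarith [tin z hz])
  have uout : ∀ z ∈ t', IsUnit (S - algebraMap ℂ A z) := fun z hz =>
    isUnit_sub_algebraMap hS (by linarith [tout z hz])
  have hprod : ∏ z ∈ s, (X - C z) = (∏ z ∈ t, (X - C z)) * ∏ z ∈ t', (X - C z) :=
    (Finset.prod_filter_mul_prod_filter_not s _ _).symm
  have hCa : star S ^ m * aeval S (C a * ∏ z ∈ s, (X - C z)) =
      a • (star S ^ m * aeval S ((∏ z ∈ t, (X - C z)) * ∏ z ∈ t', (X - C z))) := by
    rw [hprod, map_mul, aeval_C, ← Algebra.smul_def, mul_smul_comm]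
  have hT' : IsUnit (star S ^ m * aeval S ((∏ z ∈ t, (X - C z)) * ∏ z ∈ t', (X - C z))) := by
    rw [hCa] at hT
    have h1 := ((IsUnit.mk0 _ (inv_ne_zero ha)).map (algebraMap ℂ A)).mul hT
    rwa [← Algebra.smul_def, inv_smul_smul₀ ha] at h1
  have hcard : t.card = m := card_eq_of_isUnit hS hR uin uout hT'
  have hcard' : t.card + t'.card = s.card := Finset.card_filter_add_card_filter_not _
  -- Here `1 ≤ m < s.card` enters: the partial fractions need roots on both sides of the circle.
  have hne : t.Nonempty := Finset.card_pos.1 (by omega)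
  have hne' : t'.Nonempty := Finset.card_pos.1 (by omega)
  set c : ℂ → ℂ := fun i => ∏ j ∈ t'.erase i, (i - j)⁻¹ with hc
  set d : ℂ → ℂ := fun i => ∏ j ∈ t.erase i, (i * (i - j)⁻¹) with hdd
  set F : ℂ → A := fun z => Ring.inverse (S - algebraMap ℂ A z) with hF
  set G : ℂ → A := fun z => Ring.inverse (1 - z • star S) with hG
  have hplus : aeval S (∏ z ∈ t', (X - C z)) * ∑ i ∈ t', c i • F i = 1 :=
    aeval_prod_mul_sum S t' _ c F (sum_prod_X_sub_C t' hne') fun i hi => by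
      simpa using Ring.mul_inverse_cancel _ (uout i hi)
  have hminus : aeval (star S) (∏ z ∈ t, (1 - C z * X)) * ∑ i ∈ t, d i • G i = 1 :=
    aeval_prod_mul_sum (star S) t _ d G (sum_prod_one_sub t hne fun h => h0 (hts h)) fun i hi => by
      rw [aeval_one_sub]
      exact Ring.mul_inverse_cancel _ (uin i hi)
  have hinv : star S ^ m * aeval S (C a * ∏ z ∈ s, (X - C z)) *
      (a⁻¹ • ((∑ i ∈ t', c i • F i) * ∑ i ∈ t, d i • G i)) = 1 := by
    rw [hCa, smul_mul_smul_comm, mul_inv_cancel₀ ha, one_smul, map_mul, ← mul_assoc, ← hcard,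
      ← mul_assoc (star S ^ _), pow_card_mul_aeval_prod hS, mul_assoc _ _ (∑ i ∈ t', c i • F i), hplus, mul_one, hminus]
  -- A right inverse of a unit is its inverse, so the other product need not be computed.
  have hinv' : Ring.inverse (star S ^ m * aeval S (C a * ∏ z ∈ s, (X - C z))) =
      a⁻¹ • ((∑ i ∈ t', c i • F i) * ∑ i ∈ t, d i • G i) := by
    calc _ = Ring.inverse (star S ^ m * aeval S (C a * ∏ z ∈ s, (X - C z))) *
          (star S ^ m * aeval S (C a * ∏ z ∈ s, (X - C z)) *
          (a⁻¹ • ((∑ i ∈ t', c i • F i) * ∑ i ∈ t, d i • G i))) := by rw [hinv, mul_one]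
      _ = _ := by rw [← mul_assoc, Ring.inverse_mul_cancel _ hT, one_mul]
  rw [hinv', norm_smul, norm_inv]
  refine mul_le_mul_of_nonneg_left ?_ (by positivity)
  have hcn : ∀ i ∈ t', ‖c i‖ ≤ η⁻¹ ^ s.card := fun i hi =>
    norm_prod_erase_le hη hη1 (fun j hj => by
      rw [norm_inv]
      exact inv_anti₀ hη (hd _ (hts' hi) _ (hts' (Finset.mem_of_mem_erase hj))
        (Finset.ne_of_mem_erase hj).symm)) (Finset.card_le_card hts')
  have hdn : ∀ i ∈ t, ‖d i‖ ≤ η⁻¹ ^ s.card := fun i hi =>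
    norm_prod_erase_le hη hη1 (fun j hj => by
      rw [norm_mul, norm_inv]
      refine (mul_le_of_le_one_left (by positivity) (by linarith [tin i hi])).trans ?_
      exact inv_anti₀ hη (hd _ (hts hi) _ (hts (Finset.mem_of_mem_erase hj))
        (Finset.ne_of_mem_erase hj).symm)) (Finset.card_le_card hts)
  rw [Finset.sum_mul_sum]
  have hK : ∀ i ∈ t', ∀ j ∈ t, ‖(c i • F i) * (d j • G j)‖ ≤
      (η⁻¹ ^ s.card) ^ 2 * (4 / (η * δ)) := fun i hi j hj => by
    rw [smul_mul_smul_comm, norm_smul, norm_mul, sq]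
    refine mul_le_mul (mul_le_mul (hcn i hi) (hdn j hj) (norm_nonneg _) (by positivity)) ?_
      (norm_nonneg _) (by positivity)
    have hij : i ≠ j := fun h => by
      have h1 := tin j hj
      have h2 := tout i hi
      rw [h] at h2; linarith
    exact norm_resolvent_mul_coresolvent_le hS hδ hδ1 hη (tin j hj) (tout i hi)
      (hd _ (hts' hi) _ (hts hj) hij) (Ring.inverse_mul_cancel _ (uout i hi))
      (Ring.mul_inverse_cancel _ (uout i hi)) (Ring.inverse_mul_cancel _ (uin j hj))
      (Ring.mul_inverse_cancel _ (uin j hj))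
  calc _ ≤ ∑ _i ∈ t', ∑ _j ∈ t, (η⁻¹ ^ s.card) ^ 2 * (4 / (η * δ)) :=
        (norm_sum_le _ _).trans (Finset.sum_le_sum fun i hi =>
          (norm_sum_le _ _).trans (Finset.sum_le_sum fun j hj => hK i hi j hj))
    _ = (t'.card * t.card : ℝ) * ((η⁻¹ ^ s.card) ^ 2 * (4 / (η * δ))) := by
        simp [mul_assoc]
    _ ≤ (s.card * s.card : ℝ) * ((η⁻¹ ^ s.card) ^ 2 * (4 / (η * δ))) := by
        have h1 : (t'.card : ℝ) ≤ s.card := by exact_mod_cast Finset.card_le_card hts'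
        have h2 : (t.card : ℝ) ≤ s.card := by exact_mod_cast Finset.card_le_card hts
        gcongr
    _ = _ := by ring

end HardyToeplitz

namespace HardyToeplitz

open MeasureTheory Polynomial
open scoped ComplexConjugate ENNReal

/-! ### Toeplitz operators with monomial symbols and the shift -/

noncomputable section

theorem coeFn_mulOp (φ : C(UnitAddCircle, ℂ)) (f : L2) :
    mulOp (ContinuousMap.toLp ∞ AddCircle.haarAddCircle ℂ φ) f
      =ᵐ[AddCircle.haarAddCircle] fun x => φ x * f x := by
  rw [mulOp, ContinuousLinearMap.holderL_apply_apply]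
  filter_upwards [ContinuousLinearMap.coeFn_holder (r := 2) (ContinuousLinearMap.mul ℂ ℂ)
    (ContinuousMap.toLp ∞ AddCircle.haarAddCircle ℂ φ) f,
    ContinuousMap.coeFn_toLp (p := ∞) (𝕜 := ℂ) AddCircle.haarAddCircle φ] with x h1 h2
  rw [h1, h2, ContinuousLinearMap.mul_apply']

/-- Multiplication by `t ^ n` on `L²(𝕋)`. -/
def mulFourier (n : ℤ) : L2 →L[ℂ] L2 :=
  mulOp (ContinuousMap.toLp ∞ AddCircle.haarAddCircle ℂ (fourier n))

theorem mulFourier_mulFourier (a b : ℤ) (f : L2) :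
    mulFourier a (mulFourier b f) = mulFourier (a + b) f := by
  apply Lp.ext
  filter_upwards [coeFn_mulOp (fourier a) (mulFourier b f), coeFn_mulOp (fourier b) f,
    coeFn_mulOp (fourier (a + b)) f] with x h1 h2 h3
  rw [mulFourier, h1, mulFourier, h2, mulFourier, h3, fourier_add, mul_assoc]

theorem mulFourier_zero (f : L2) : mulFourier 0 f = f := by
  apply Lp.ext
  filter_upwards [coeFn_mulOp (fourier 0) f] with x h1
  rw [mulFourier, h1, fourier_zero, one_mul]

theorem inner_mulFourier (n : ℤ) (f g : L2) :
    inner ℂ (mulFourier n f) g = inner ℂ f (mulFourier (-n) g) := by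
  rw [L2.inner_def, L2.inner_def]
  apply integral_congr_ae
  filter_upwards [coeFn_mulOp (fourier n) f, coeFn_mulOp (fourier (-n)) g] with x h1 h2
  rw [mulFourier, h1, mulFourier, h2, fourier_neg]
  simp only [RCLike.inner_apply, map_mul]
  ring

theorem mulFourier_fourierLp (n k : ℤ) : mulFourier n (fourierLp 2 k) = fourierLp 2 (n + k) := by
  apply Lp.ext
  filter_upwards [coeFn_mulOp (fourier n) (fourierLp 2 k), coeFn_fourierLp (T := (1 : ℝ)) 2 k,
    coeFn_fourierLp (T := (1 : ℝ)) 2 (n + k)] with x h1 h2 h3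
  rw [mulFourier, h1, h2, h3, fourier_add]

theorem mem_H2_iff_inner (f : L2) :
    f ∈ H2 ↔ ∀ n : ℤ, n < 0 → inner ℂ (fourierLp (T := (1 : ℝ)) 2 n) f = 0 := by
  rw [mem_H2_iff]
  refine forall₂_congr fun n _ => ?_
  rw [← fourierBasis_repr, HilbertBasis.repr_apply_apply, coe_fourierBasis]

theorem mulFourier_one_mem (f : H2) : mulFourier 1 f ∈ H2 := by
  rw [mem_H2_iff_inner]
  intro n hn
  rw [← inner_conj_symm, inner_mulFourier, mulFourier_fourierLp, inner_conj_symm]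
  exact (mem_H2_iff_inner _).1 f.2 _ (by omega)

/-- The Toeplitz operator with symbol `t ^ n`. -/
def toeplitzFourier (n : ℤ) : H2 →L[ℂ] H2 :=
  H2.orthogonalProjectionOnto ∘L mulFourier n ∘L H2.subtypeL

theorem toeplitzFourier_apply (n : ℤ) (f : H2) :
    toeplitzFourier n f = H2.orthogonalProjectionOnto (mulFourier n f) := rfl

theorem toeplitzFourier_zero : toeplitzFourier 0 = 1 := by
  ext1 f
  rw [toeplitzFourier_apply, mulFourier_zero, Submodule.orthogonalProjectionOnto_mem_subspace_eq_self]
  rfl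

theorem star_toeplitzFourier (n : ℤ) : star (toeplitzFourier n) = toeplitzFourier (-n) := by
  rw [ContinuousLinearMap.star_eq_adjoint, eq_comm, ContinuousLinearMap.eq_adjoint_iff]
  intro f g
  rw [toeplitzFourier_apply, toeplitzFourier_apply,
    Submodule.inner_orthogonalProjectionOnto_eq_of_mem_right,
    Submodule.inner_orthogonalProjectionOnto_eq_of_mem_left, inner_mulFourier, neg_neg]

theorem toeplitzFourier_mul_shift (n : ℤ) :
    toeplitzFourier n * toeplitzFourier 1 = toeplitzFourier (n + 1) := by
  ext1 f
  have h : ((toeplitzFourier 1 f : H2) : L2) = mulFourier 1 f := by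
    rw [toeplitzFourier_apply]
    exact congrArg Subtype.val
      (Submodule.orthogonalProjectionOnto_mem_subspace_eq_self (⟨_, mulFourier_one_mem f⟩ : H2))
  rw [mul_apply_eq_comp, toeplitzFourier_apply n, h, mulFourier_mulFourier,
    toeplitzFourier_apply]

theorem backshift_mul_toeplitzFourier (n : ℤ) :
    star (toeplitzFourier 1) * toeplitzFourier n = toeplitzFourier (n - 1) := by
  have h := star_mul (toeplitzFourier (-n)) (toeplitzFourier 1)
  rw [toeplitzFourier_mul_shift, star_toeplitzFourier (-n), star_toeplitzFourier (-n + 1),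
    neg_neg, neg_add, neg_neg] at h
  exact h.symm

theorem star_shift_mul_shift : star (toeplitzFourier 1) * toeplitzFourier 1 = 1 := by
  rw [backshift_mul_toeplitzFourier, sub_self, toeplitzFourier_zero]

theorem shift_pow (n : ℕ) : toeplitzFourier 1 ^ n = toeplitzFourier n := by
  induction n with
  | zero => simp [toeplitzFourier_zero]
  | succ n ih => rw [pow_succ, ih, toeplitzFourier_mul_shift]; simp

theorem backshift_pow_mul_shift_pow (m n : ℕ) :
    star (toeplitzFourier 1) ^ m * toeplitzFourier 1 ^ n = toeplitzFourier (n - m) := by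
  rw [shift_pow]
  induction m with
  | zero => simp
  | succ m ih =>
    rw [pow_succ', mul_assoc, ih, backshift_mul_toeplitzFourier]
    congr 1
    push_cast
    ring

/-- The backward shift annihilates the constant function `1`. -/
theorem not_isUnit_backshift : ¬ IsUnit (star (toeplitzFourier 1)) := by
  intro h
  have h0 : fourierLp (T := (1 : ℝ)) 2 0 ∈ H2 := by
    rw [mem_H2_iff_inner]
    intro n hn
    exact orthonormal_fourier.2 hn.ne
  have h1 : star (toeplitzFourier 1) ⟨_, h0⟩ = 0 := by
    rw [star_toeplitzFourier, toeplitzFourier_apply, mulFourier_fourierLp,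
      Submodule.orthogonalProjectionOnto_eq_zero_iff, H2]
    exact Submodule.le_orthogonal_orthogonal _ (Submodule.subset_span ⟨_, by norm_num, rfl⟩)
  obtain ⟨u, hu⟩ := h
  have h2 : (⟨_, h0⟩ : H2) = 0 := by
    have h3 : (↑u⁻¹ * ↑u : H2 →L[ℂ] H2) ⟨_, h0⟩ = ⟨_, h0⟩ := by rw [u.inv_mul]; rfl
    rw [hu, mul_apply_eq_comp, h1, map_zero] at h3
    exact h3.symm
  exact orthonormal_fourier.ne_zero 0 (congrArg Subtype.val h2)

/-- The polynomial `z ^ m (b(z) - w)`. -/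
def shiftedPoly (b : LaurentPolynomial ℂ) (m k : ℕ) (w : ℂ) : ℂ[X] :=
  ∑ n ∈ Finset.range (m + k + 1), C (b.coeff ((n : ℤ) - m)) * X ^ n - C w * X ^ m

theorem sum_coeff_eq {M : Type*} [AddCommMonoid M] {m k : ℕ} {b : LaurentPolynomial ℂ}
    (hb : ∀ n : ℤ, n < -(m : ℤ) ∨ (k : ℤ) < n → b.coeff n = 0) (f : ℤ → ℂ → M)
    (hf : ∀ n, f n 0 = 0) :
    b.coeff.sum f = ∑ n ∈ Finset.range (m + k + 1), f ((n : ℤ) - m) (b.coeff ((n : ℤ) - m)) := by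
  have hinj : Set.InjOn (fun n : ℕ => (n : ℤ) - m) (Finset.range (m + k + 1)) := by
    intro x _ y _ h
    simp only at h
    omega
  rw [Finsupp.sum_of_support_subset (s := (Finset.range (m + k + 1)).image fun n : ℕ => (n : ℤ) - m),
    Finset.sum_image hinj]
  · intro n hn
    have h1 : ¬ (n < -(m : ℤ) ∨ (k : ℤ) < n) := fun h => Finsupp.mem_support_iff.1 hn (hb n h)
    push Not at h1
    exact Finset.mem_image.2 ⟨(n + m).toNat, Finset.mem_range.2 (by omega), by omega⟩
  · exact fun n _ => hf n

theorem toeplitz_sum {ι : Type*} (s : Finset ι) (c : ι → ℂ) (e : ι → ℤ) :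
    toeplitz (ContinuousMap.toLp ∞ AddCircle.haarAddCircle ℂ (∑ i ∈ s, c i • fourier (e i))) =
      ∑ i ∈ s, c i • toeplitzFourier (e i) := by
  ext1 f
  simp only [toeplitz, mulOp, toeplitzFourier, mulFourier, map_sum, map_smul,
    sum_apply, smul_apply, ContinuousLinearMap.comp_apply]

/-- Toeplitz operators are not multiplicative in general, but `S*^m S^n` is the one with symbol
`t^(n-m)`, because all adjoints stand on the left. Both sides are then compared monomial by
monomial. -/
theorem toeplitzLaurent_sub {m k : ℕ} {b : LaurentPolynomial ℂ}
    (hb : ∀ n : ℤ, n < -(m : ℤ) ∨ (k : ℤ) < n → b.coeff n = 0) (w : ℂ) :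
    toeplitzLaurent b - algebraMap ℂ _ w =
      star (toeplitzFourier 1) ^ m * aeval (toeplitzFourier 1) (shiftedPoly b m k w) := by
  rw [toeplitzLaurent, symbCircle, sum_coeff_eq hb (fun n c => c • fourier n) (fun n => by ext1 x; simp), toeplitz_sum, shiftedPoly, map_sub,
    mul_sub, map_sum, Finset.mul_sum]
  congr 1
  · refine Finset.sum_congr rfl fun n _ => ?_
    rw [map_mul, aeval_C, map_pow, aeval_X, ← Algebra.smul_def, mul_smul_comm,
      backshift_pow_mul_shift_pow]
  · rw [map_mul, aeval_C, map_pow, aeval_X, ← Algebra.smul_def, mul_smul_comm,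
      backshift_pow_mul_shift_pow, sub_self, toeplitzFourier_zero, Algebra.algebraMap_eq_smul_one]

end

end HardyToeplitz

namespace HardyToeplitz

open MeasureTheory Polynomial Filter Topology
open scoped ComplexConjugate ENNReal

/-! ### Roots of the equation `b(z) = w` -/

section Symbol

variable {m k : ℕ} {b : LaurentPolynomial ℂ}

theorem eval_shiftedPoly (hb : ∀ n : ℤ, n < -(m : ℤ) ∨ (k : ℤ) < n → b.coeff n = 0) (w : ℂ) {z : ℂ}
    (hz : z ≠ 0) : (shiftedPoly b m k w).eval z = z ^ m * (symb b z - w) := by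
  rw [symb, sum_coeff_eq hb (fun n c => c * z ^ n) (by simp), shiftedPoly, eval_sub,
    eval_finsetSum, mul_sub, Finset.mul_sum]
  congr 1
  · refine Finset.sum_congr rfl fun n _ => ?_
    rw [eval_mul, eval_C, eval_pow, eval_X, zpow_sub₀ hz, zpow_natCast, zpow_natCast]
    field_simp
  · rw [eval_mul, eval_C, eval_pow, eval_X, mul_comm]

theorem coeff_shiftedPoly (w : ℂ) (i : ℕ) : (shiftedPoly b m k w).coeff i =
    (if i < m + k + 1 then b.coeff ((i : ℤ) - m) else 0) - if i = m then w else 0 := by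
  simp [shiftedPoly, coeff_X_pow]

theorem natDegree_shiftedPoly (hk : 1 ≤ k) (hbk : b.coeff (k : ℤ) ≠ 0) (w : ℂ) :
    (shiftedPoly b m k w).natDegree = m + k := by
  refine natDegree_eq_of_le_of_coeff_ne_zero ?_ ?_
  · rw [natDegree_le_iff_coeff_eq_zero]
    intro N hN
    rw [coeff_shiftedPoly, if_neg (by omega), if_neg (by omega), sub_zero]
  · rw [coeff_shiftedPoly, if_pos (by omega), if_neg (by omega), sub_zero]
    simpa using hbk

theorem leadingCoeff_shiftedPoly (hk : 1 ≤ k) (hbk : b.coeff (k : ℤ) ≠ 0) (w : ℂ) :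
    (shiftedPoly b m k w).leadingCoeff = b.coeff (k : ℤ) := by
  rw [leadingCoeff, natDegree_shiftedPoly hk hbk, coeff_shiftedPoly, if_pos (by omega),
    if_neg (by omega), sub_zero]
  simp

theorem eval_zero_shiftedPoly_ne_zero (hm : 1 ≤ m) (hbm : b.coeff (-(m : ℤ)) ≠ 0) (w : ℂ) :
    (shiftedPoly b m k w).eval 0 ≠ 0 := by
  rw [← coeff_zero_eq_eval_zero, coeff_shiftedPoly, if_pos (by omega), if_neg (by omega), sub_zero]
  simpa using hbm

theorem analyticAt_symb (b : LaurentPolynomial ℂ) {z : ℂ} (hz : z ≠ 0) :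
    AnalyticAt ℂ (symb b) z := by
  have h : DifferentiableOn ℂ (symb b) {0}ᶜ := by
    intro x hx
    refine DifferentiableAt.differentiableWithinAt ?_
    unfold symb Finsupp.sum
    exact DifferentiableAt.fun_sum fun n _ =>
      (differentiableAt_const _).mul (differentiableAt_zpow.2 (Or.inl hx))
  exact h.analyticAt (isOpen_compl_singleton.mem_nhds hz)

/-- At a root the term with the derivative of `z^m` drops out, so simplicity of the root is read off
from `b'`. -/
theorem eval_derivative_shiftedPoly
    (hb : ∀ n : ℤ, n < -(m : ℤ) ∨ (k : ℤ) < n → b.coeff n = 0) {w z : ℂ}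
    (hz : z ≠ 0) (hw : symb b z = w) :
    (derivative (shiftedPoly b m k w)).eval z = z ^ m * deriv (symb b) z := by
  have h1 := (shiftedPoly b m k w).hasDerivAt z
  have h2 : HasDerivAt (fun x => x ^ m * (symb b x - w))
      (m * z ^ (m - 1) * (symb b z - w) + z ^ m * deriv (symb b) z) z :=
    (hasDerivAt_pow m z).mul
      ((analyticAt_symb b hz).differentiableAt.hasDerivAt.sub_const w)
  have h3 : (fun x => eval x (shiftedPoly b m k w)) =ᶠ[𝓝 z] fun x => x ^ m * (symb b x - w) := by
    filter_upwards [isOpen_compl_singleton.mem_nhds hz] with x hx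
    exact eval_shiftedPoly hb w hx
  rw [h1.unique (h2.congr_of_eventuallyEq h3), hw, sub_self, mul_zero, zero_add]

/-- The roots of `b(z) = w`. -/
noncomputable def symbRoots (b : LaurentPolynomial ℂ) (m k : ℕ) (w : ℂ) : Finset ℂ :=
  (shiftedPoly b m k w).roots.toFinset

theorem shiftedPoly_ne_zero (hm : 1 ≤ m) (hbm : b.coeff (-(m : ℤ)) ≠ 0) (w : ℂ) :
    shiftedPoly b m k w ≠ 0 := fun h =>
  eval_zero_shiftedPoly_ne_zero (k := k) hm hbm w (by rw [h, eval_zero])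

theorem mem_symbRoots (hm : 1 ≤ m) (hbm : b.coeff (-(m : ℤ)) ≠ 0)
    (hb : ∀ n : ℤ, n < -(m : ℤ) ∨ (k : ℤ) < n → b.coeff n = 0) (w z : ℂ) :
    z ∈ symbRoots b m k w ↔ z ≠ 0 ∧ symb b z = w := by
  rw [symbRoots, Multiset.mem_toFinset, mem_roots (shiftedPoly_ne_zero hm hbm w), IsRoot.def]
  constructor
  · intro h
    have hz : z ≠ 0 := by
      rintro rfl
      exact eval_zero_shiftedPoly_ne_zero hm hbm w h
    rw [eval_shiftedPoly hb w hz, mul_eq_zero, sub_eq_zero] at h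
    exact ⟨hz, h.resolve_left (pow_ne_zero _ hz)⟩
  · rintro ⟨hz, h⟩
    rw [eval_shiftedPoly hb w hz, h, sub_self, mul_zero]

theorem nodup_roots_shiftedPoly (hm : 1 ≤ m) (hbm : b.coeff (-(m : ℤ)) ≠ 0)
    (hb : ∀ n : ℤ, n < -(m : ℤ) ∨ (k : ℤ) < n → b.coeff n = 0) {w : ℂ}
    (hw : ∀ z ∈ symbRoots b m k w, deriv (symb b) z ≠ 0) : (shiftedPoly b m k w).roots.Nodup := by
  rw [Multiset.nodup_iff_count_le_one]
  intro z
  rw [count_roots]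
  by_contra! h
  have h0 := shiftedPoly_ne_zero (k := k) hm hbm w
  rw [one_lt_rootMultiplicity_iff_isRoot h0] at h
  have hz : z ∈ symbRoots b m k w := Multiset.mem_toFinset.2 ((mem_roots h0).2 h.1)
  have hz' := (mem_symbRoots hm hbm hb w z).1 hz
  have h2 := h.2
  rw [IsRoot.def, eval_derivative_shiftedPoly hb hz'.1 hz'.2, mul_eq_zero] at h2
  exact h2.elim (pow_ne_zero _ hz'.1) (hw z hz)

theorem shiftedPoly_eq_prod (hm : 1 ≤ m) (hk : 1 ≤ k) (hbm : b.coeff (-(m : ℤ)) ≠ 0)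
    (hbk : b.coeff (k : ℤ) ≠ 0) (hb : ∀ n : ℤ, n < -(m : ℤ) ∨ (k : ℤ) < n → b.coeff n = 0) {w : ℂ}
    (hw : ∀ z ∈ symbRoots b m k w, deriv (symb b) z ≠ 0) :
    shiftedPoly b m k w = C (b.coeff (k : ℤ)) * ∏ z ∈ symbRoots b m k w, (X - C z) := by
  have h := (IsAlgClosed.splits (shiftedPoly b m k w)).eq_prod_roots
  rw [leadingCoeff_shiftedPoly hk hbk] at h
  rw [Finset.prod, symbRoots, Multiset.toFinset_val,
    (nodup_roots_shiftedPoly hm hbm hb hw).dedup]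
  exact h

theorem card_symbRoots (hm : 1 ≤ m) (hk : 1 ≤ k) (hbm : b.coeff (-(m : ℤ)) ≠ 0)
    (hbk : b.coeff (k : ℤ) ≠ 0) (hb : ∀ n : ℤ, n < -(m : ℤ) ∨ (k : ℤ) < n → b.coeff n = 0) {w : ℂ}
    (hw : ∀ z ∈ symbRoots b m k w, deriv (symb b) z ≠ 0) :
    (symbRoots b m k w).card = m + k := by
  rw [symbRoots, Multiset.toFinset_card_of_nodup (nodup_roots_shiftedPoly hm hbm hb hw),
    ← (IsAlgClosed.splits (shiftedPoly b m k w)).natDegree_eq_card_roots,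
    natDegree_shiftedPoly hk hbk]

/-- The roots of `b(z) = w` depend continuously on `w`. -/
theorem exists_root_near (hm : 1 ≤ m) (hk : 1 ≤ k) (hbm : b.coeff (-(m : ℤ)) ≠ 0)
    (hbk : b.coeff (k : ℤ) ≠ 0) (hb : ∀ n : ℤ, n < -(m : ℤ) ∨ (k : ℤ) < n → b.coeff n = 0) {w₀ : ℂ}
    (hw₀ : ∀ z ∈ symbRoots b m k w₀, deriv (symb b) z ≠ 0) {r : ℝ} (hr : 0 < r) :
    ∃ ε > 0, ∀ w : ℂ, ‖w - w₀‖ < ε → ∀ z ∈ symbRoots b m k w,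
      ∃ ζ ∈ symbRoots b m k w₀, ‖z - ζ‖ < r := by
  set s := symbRoots b m k w₀ with hs
  obtain ⟨M, hM⟩ : ∃ M : ℝ, ∀ ζ ∈ s, ‖ζ‖ ≤ M := by
    obtain ⟨M, hM⟩ := (s.image fun ζ => ‖ζ‖).exists_le
    exact ⟨M, fun ζ hζ => hM _ (Finset.mem_image_of_mem _ hζ)⟩
  -- Chosen so that `‖z‖ + 1 ≤ t ‖z - ζ‖` for every root `ζ` of `b = w₀` with `‖z - ζ‖ ≥ r`,
  -- uniformly in `z`. Multiplying over the `m + k` roots, a `z` far from all of them would force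
  -- `‖w - w₀‖ ≥ ‖b_k‖ / t^(m+k)`.
  set t : ℝ := (|M| + 1) / r + 1 with ht
  have ht0 : 0 < t := by positivity
  refine ⟨‖b.coeff (k : ℤ)‖ / t ^ (m + k), div_pos (norm_pos_iff.2 hbk) (by positivity), ?_⟩
  intro w hw z hz
  by_contra! hfar
  obtain ⟨hz0, hzw⟩ := (mem_symbRoots hm hbm hb w z).1 hz
  have h1 : b.coeff (k : ℤ) * ∏ ζ ∈ s, (z - ζ) = z ^ m * (w - w₀) := by
    have := eval_shiftedPoly hb w₀ hz0
    rw [shiftedPoly_eq_prod hm hk hbm hbk hb hw₀, eval_mul, eval_C, eval_prod, hzw] at this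
    simpa using this
  have h2 : (‖z‖ + 1) ^ (m + k) ≤ t ^ (m + k) * ∏ ζ ∈ s, ‖z - ζ‖ := by
    rw [← card_symbRoots hm hk hbm hbk hb hw₀, ← hs, ← Finset.prod_const, ← Finset.prod_const,
      ← Finset.prod_mul_distrib]
    refine Finset.prod_le_prod (fun _ _ => by positivity) fun ζ hζ => ?_
    have h3 : ‖z‖ ≤ ‖ζ‖ + ‖z - ζ‖ := by
      have := norm_add_le ζ (z - ζ)
      rwa [add_sub_cancel] at this
    have h4 : |M| + 1 ≤ (|M| + 1) / r * ‖z - ζ‖ := by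
      rw [div_mul_eq_mul_div, le_div_iff₀ hr]
      exact mul_le_mul_of_nonneg_left (hfar ζ hζ) (by positivity)
    have h5 := hM ζ hζ
    have h6 := le_abs_self M
    rw [ht, add_mul, one_mul]
    linarith
  have h3 : ‖z‖ ^ m ≤ (‖z‖ + 1) ^ (m + k) :=
    (pow_le_pow_left₀ (norm_nonneg _) (by linarith) _).trans
      (pow_le_pow_right₀ (by linarith [norm_nonneg z]) (by omega))
  have h4 : ‖b.coeff (k : ℤ)‖ * ∏ ζ ∈ s, ‖z - ζ‖ = ‖z‖ ^ m * ‖w - w₀‖ := by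
    rw [← norm_prod, ← norm_mul, h1, norm_mul, norm_pow]
  have hp : 0 < ∏ ζ ∈ s, ‖z - ζ‖ := Finset.prod_pos fun ζ hζ => hr.trans_le (hfar ζ hζ)
  rw [lt_div_iff₀ (by positivity)] at hw
  have h5 : ‖b.coeff (k : ℤ)‖ * ∏ ζ ∈ s, ‖z - ζ‖ ≤
      (‖w - w₀‖ * t ^ (m + k)) * ∏ ζ ∈ s, ‖z - ζ‖ := by
    rw [h4]
    calc _ ≤ (t ^ (m + k) * ∏ ζ ∈ s, ‖z - ζ‖) * ‖w - w₀‖ :=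
          mul_le_mul_of_nonneg_right (h3.trans h2) (norm_nonneg _)
      _ = _ := by ring
  exact absurd (le_of_mul_le_mul_right h5 hp) (not_le.2 hw)

end Symbol

/-! ### Local behaviour near a simple root -/

section Local

theorem eventually_injective_of_deriv_ne_zero {f : ℂ → ℂ} {ζ : ℂ} (hf : AnalyticAt ℂ f ζ)
    (hd : deriv f ζ ≠ 0) : ∃ ρ > 0, ∀ x ∈ Metric.ball ζ ρ, deriv f x ≠ 0 ∧
      ∀ y ∈ Metric.ball ζ ρ, f x = f y → x = y := by
  have h1 : ∀ᶠ x in 𝓝 ζ, HasStrictDerivAt.localInverse f _ ζ hf.hasStrictDerivAt hd (f x) = x :=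
    HasStrictDerivAt.eventually_left_inverse hf.hasStrictDerivAt hd
  have h2 : ∀ᶠ x in 𝓝 ζ, deriv f x ≠ 0 := hf.deriv.continuousAt.eventually_ne hd
  obtain ⟨ρ, hρ, h⟩ := Metric.eventually_nhds_iff_ball.1 (h1.and h2)
  refine ⟨ρ, hρ, fun x hx => ⟨(h x hx).2, fun y hy hxy => ?_⟩⟩
  rw [← (h x hx).1, hxy, (h y hy).1]

/-- To first order `z - ζ` is `(f z - f ζ) / f' ζ`, so the cone condition bounds below the radial
part `Re (conj ζ (z - ζ))`. That part governs `‖z‖² - 1 = 2 Re (conj ζ (z - ζ)) + ‖z - ζ‖²`. -/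
theorem abs_norm_sub_one_ge_of_cone {f : ℂ → ℂ} {ζ : ℂ} (hf : DifferentiableAt ℂ f ζ)
    (hd : deriv f ζ ≠ 0) (hζ : ‖ζ‖ = 1) {c : ℝ} (hc : 0 < c) : ∃ ρ > 0, ∀ z ∈ Metric.ball ζ ρ,
      c * ‖f z - f ζ‖ < |(conj ζ / deriv f ζ * (f z - f ζ)).re| →
        c / 3 * ‖f z - f ζ‖ ≤ |‖z‖ - 1| := by
  set D := ‖deriv f ζ‖ with hD
  have hD0 : 0 < D := norm_pos_iff.2 hd
  -- `D / 2` yields `D ‖v‖ ≤ 2 ‖u‖`; `c D² / 8` then keeps the linearization error below `(c / 4)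
  -- ‖u‖`.
  set κ := min (D / 2) (c * D ^ 2 / 8) with hκ
  have hκ0 : 0 < κ := lt_min (by positivity) (by positivity)
  have hκ1 : κ ≤ D / 2 := min_le_left _ _
  have hκ2 : κ ≤ c * D ^ 2 / 8 := min_le_right _ _
  have hlo := (hasDerivAt_iff_isLittleO.1 hf.hasDerivAt).def hκ0
  obtain ⟨ρ, hρ, h⟩ := Metric.eventually_nhds_iff_ball.1 hlo
  -- Radius `c D / 4` makes `‖v‖² ≤ (c / 2) ‖u‖`; radius `1` gives `‖z‖ + 1 ≤ 3`, the source of the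
  -- `3` in `c / 3`.
  refine ⟨min (min ρ 1) (c * D / 4), by positivity, fun z hz hcone => ?_⟩
  rw [Metric.mem_ball, dist_eq_norm, lt_min_iff, lt_min_iff] at hz
  obtain ⟨⟨hz1, hz2⟩, hz3⟩ := hz
  have he := h z (by rwa [Metric.mem_ball, dist_eq_norm])
  set v := z - ζ with hv
  set u := f z - f ζ with hu
  set e := u - v • deriv f ζ with hee
  have hDv : D * ‖v‖ ≤ ‖u‖ + κ * ‖v‖ := by
    have h1 : v • deriv f ζ = u - e := by rw [hee]; abel
    calc D * ‖v‖ = ‖v • deriv f ζ‖ := by rw [norm_smul, mul_comm]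
      _ ≤ ‖u‖ + ‖e‖ := by rw [h1]; exact norm_sub_le _ _
      _ ≤ _ := by linarith
  have hv1 : D * ‖v‖ ≤ 2 * ‖u‖ := by nlinarith [norm_nonneg v]
  have hre : (conj ζ * v).re = (conj ζ / deriv f ζ * u).re - (conj ζ / deriv f ζ * e).re := by
    rw [← Complex.sub_re]
    congr 1
    rw [hee, smul_eq_mul]
    field_simp
    ring
  have hcz : ‖conj ζ / deriv f ζ‖ = D⁻¹ := by
    rw [norm_div, RCLike.norm_conj, hζ, one_div]
  have hre2 : |(conj ζ / deriv f ζ * e).re| ≤ c / 4 * ‖u‖ := by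
    refine (Complex.abs_re_le_norm _).trans ?_
    rw [norm_mul, hcz, inv_mul_le_iff₀ hD0]
    refine he.trans ?_
    have h1 : κ * ‖v‖ ≤ c * D ^ 2 / 8 * ‖v‖ := mul_le_mul_of_nonneg_right hκ2 (norm_nonneg _)
    nlinarith [mul_le_mul_of_nonneg_left hv1 (by positivity : 0 ≤ c * D / 8)]
  have hre3 : 3 / 4 * c * ‖u‖ ≤ |(conj ζ * v).re| := by
    rw [hre]
    have := abs_sub_abs_le_abs_sub (conj ζ / deriv f ζ * u).re (conj ζ / deriv f ζ * e).re
    linarith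
  have hvsq : ‖v‖ ^ 2 ≤ c / 2 * ‖u‖ := by
    have h1 : ‖v‖ * ‖v‖ ≤ c * D / 4 * ‖v‖ := mul_le_mul_of_nonneg_right hz3.le (norm_nonneg _)
    nlinarith [mul_le_mul_of_nonneg_left hv1 (by positivity : 0 ≤ c / 4)]
  have hnz : ‖z‖ ^ 2 - 1 = 2 * (conj ζ * v).re + ‖v‖ ^ 2 := by
    have h1 : z = ζ + v := by rw [hv]; abel
    have h2 : ‖ζ‖ ^ 2 = 1 := by rw [hζ, one_pow]
    rw [h1, ← h2, ← Complex.normSq_eq_norm_sq, ← Complex.normSq_eq_norm_sq,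
      ← Complex.normSq_eq_norm_sq, Complex.normSq_apply, Complex.normSq_apply, Complex.normSq_apply]
    simp
    ring
  have hz2' : ‖z‖ ≤ 2 := by
    have h1 : z = ζ + v := by rw [hv]; abel
    rw [h1]
    exact (norm_add_le _ _).trans (by linarith)
  have hfin : c * ‖u‖ ≤ |‖z‖ ^ 2 - 1| := by
    rw [hnz]
    have h1 := abs_sub_abs_le_abs_sub (2 * (conj ζ * v).re) (-‖v‖ ^ 2)
    rw [abs_mul, abs_two, abs_neg, abs_of_nonneg (sq_nonneg ‖v‖), sub_neg_eq_add] at h1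
    linarith
  have hfac : |‖z‖ ^ 2 - 1| = |‖z‖ - 1| * (‖z‖ + 1) := by
    rw [show ‖z‖ ^ 2 - 1 = (‖z‖ - 1) * (‖z‖ + 1) by ring, abs_mul,
      abs_of_nonneg (by positivity : 0 ≤ ‖z‖ + 1)]
  nlinarith [abs_nonneg (‖z‖ - 1)]

/-- The local behaviour of `f` near a simple root `ζ` of `f z = w₀`, at all small scales `r`. -/
theorem eventually_local_estimates {f : ℂ → ℂ} {ζ w₀ : ℂ} (hf : AnalyticAt ℂ f ζ)
    (hd : deriv f ζ ≠ 0) (hw₀ : f ζ = w₀) {c : ℝ} (hc : 0 < c) : ∀ᶠ r : ℝ in 𝓝[>] 0,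
      (∀ x ∈ Metric.ball ζ (2 * r), deriv f x ≠ 0 ∧
        ∀ y ∈ Metric.ball ζ (2 * r), f x = f y → x = y) ∧
      ∀ z ∈ Metric.ball ζ r, ‖f z - w₀‖ ≤ 1 →
        (‖ζ‖ = 1 → c * ‖f z - w₀‖ < |(conj ζ / deriv f ζ * (f z - w₀)).re|) →
          min (c / 3) r * ‖f z - w₀‖ ≤ |‖z‖ - 1| := by
  subst hw₀
  obtain ⟨ρ, hρ, h1⟩ := eventually_injective_of_deriv_ne_zero hf hd
  have hE1 : ∀ᶠ r : ℝ in 𝓝[>] 0, r ∈ Set.Ioo 0 (ρ / 2) := Ioo_mem_nhdsGT (by positivity)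
  have hE2 : ∀ᶠ r : ℝ in 𝓝[>] 0, ∀ z ∈ Metric.ball ζ r, ‖f z - f ζ‖ ≤ 1 →
        (‖ζ‖ = 1 → c * ‖f z - f ζ‖ < |(conj ζ / deriv f ζ * (f z - f ζ)).re|) →
          min (c / 3) r * ‖f z - f ζ‖ ≤ |‖z‖ - 1| := by
    by_cases hζ : ‖ζ‖ = 1
    · obtain ⟨σ, hσ, h2⟩ := abs_norm_sub_one_ge_of_cone hf.differentiableAt hd hζ hc
      have hE : ∀ᶠ r : ℝ in 𝓝[>] 0, r ∈ Set.Ioo 0 σ := Ioo_mem_nhdsGT hσ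
      filter_upwards [hE] with r hr z hz _ hcone
      exact (mul_le_mul_of_nonneg_right (min_le_left _ _) (norm_nonneg _)).trans
        (h2 z (Metric.ball_subset_ball hr.2.le hz) (hcone hζ))
    -- Near a root off the circle no cone is needed: `z` stays at distance more than `r` from the
    -- circle, while `‖f z - f ζ‖ ≤ 1`.
    · have hpos : 0 < |‖ζ‖ - 1| := abs_pos.2 (sub_ne_zero.2 hζ)
      have hE : ∀ᶠ r : ℝ in 𝓝[>] 0, r ∈ Set.Ioo 0 (|‖ζ‖ - 1| / 2) :=
        Ioo_mem_nhdsGT (by positivity)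
      filter_upwards [hE] with r hr z hz hz1 _
      rw [Metric.mem_ball, dist_comm, dist_eq_norm] at hz
      have h3 := abs_norm_sub_norm_le ζ z
      have h4 := abs_sub_abs_le_abs_sub (‖ζ‖ - 1) (‖z‖ - 1)
      rw [sub_sub_sub_cancel_right] at h4
      have h5 : min (c / 3) r * ‖f z - f ζ‖ ≤ r * 1 :=
        mul_le_mul (min_le_right _ _) hz1 (norm_nonneg _) hr.1.le
      linarith [hr.2]
  filter_upwards [hE1, hE2] with r hr h2
  refine ⟨fun x hx => ?_, h2⟩
  have hsub : Metric.ball ζ (2 * r) ⊆ Metric.ball ζ ρ := Metric.ball_subset_ball (by linarith [hr.2])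
  exact ⟨(h1 x (hsub hx)).1, fun y hy => (h1 x (hsub hx)).2 y (hsub hy)⟩

end Local

end HardyToeplitz

namespace HardyToeplitz

open Polynomial Filter Topology

/-! ### The resolvent estimate -/

theorem isClosed_spectrum {E : Type*} [NormedAddCommGroup E] [InnerProductSpace ℂ E]
    [CompleteSpace E] (T : E →L[ℂ] E) : IsClosed (spectrum ℂ T) := spectrum.isClosed T

/-- Non-tangential approach to a boundary point of the spectrum of `T_b` outside the set of critical
values: the resolvent is bounded by a multiple of `1 / dist (w, σ(T_b))`. -/
theorem exists_norm_inverse_sub_le (m k : ℕ) (hm : 1 ≤ m) (hk : 1 ≤ k) (b : LaurentPolynomial ℂ)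
    (hbm : b.coeff (-(m : ℤ)) ≠ 0) (hbk : b.coeff (k : ℤ) ≠ 0)
    (hb : ∀ n : ℤ, n < -(m : ℤ) ∨ (k : ℤ) < n → b.coeff n = 0)
    (w₀ : ℂ) (hw₀ : w₀ ∈ frontier (spectrum ℂ (toeplitzLaurent b)))
    (hK : w₀ ∉ criticalValues b)
    (c : ℝ) (hc : 0 < c) :
    ∃ ε₀ : ℝ, 0 < ε₀ ∧ ∀ ε : ℝ, 0 < ε → ε < ε₀ → ∃ C : ℝ, 0 < C ∧
      ∀ w ∈ Ω' b c w₀ ε,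
        ‖Ring.inverse (toeplitzLaurent b - algebraMap ℂ _ w)‖ ≤
          C / Metric.infDist w (spectrum ℂ (toeplitzLaurent b)) := by
  have hmem := mem_symbRoots hm hbm hb
  have hw₀s : w₀ ∈ spectrum ℂ (toeplitzLaurent b) :=
    (isClosed_spectrum (toeplitzLaurent b)).frontier_subset hw₀
  have hd₀ : ∀ z ∈ symbRoots b m k w₀, deriv (symb b) z ≠ 0 := fun z hz hz' =>
    hK ⟨z, ((hmem w₀ z).1 hz).1, hz', ((hmem w₀ z).1 hz).2⟩
  have hloc := (Filter.eventually_all_finset (symbRoots b m k w₀)).2 fun ζ hζ =>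
    eventually_local_estimates (analyticAt_symb b ((hmem w₀ ζ).1 hζ).1) (hd₀ ζ hζ)
      ((hmem w₀ ζ).1 hζ).2 hc
  have hr1 : ∀ᶠ r : ℝ in 𝓝[>] 0, r ∈ Set.Ioo 0 1 := Ioo_mem_nhdsGT one_pos
  obtain ⟨r, hr, ⟨hr0, hr1⟩⟩ := (hloc.and hr1).exists
  obtain ⟨ε₁, hε₁, hnear⟩ := exists_root_near hm hk hbm hbk hb hd₀ hr0
  set κ := min (c / 3) r with hκ
  have hκ0 : 0 < κ := lt_min (by positivity) hr0
  have hκ1 : κ ≤ 1 := (min_le_right _ _).trans hr1.le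
  -- The bound of `norm_inverse_le` with `η = r` and `δ = κ ‖w - w₀‖`, the factor `‖w - w₀‖⁻¹` taken
  -- out; it does not depend on `ε`.
  set K : ℝ := ‖b.coeff (k : ℤ)‖⁻¹ *
    (((m + k : ℕ) : ℝ) ^ 2 * (r⁻¹ ^ (m + k)) ^ 2 * (4 / (r * κ))) with hKdef
  have hbk0 : 0 < ‖b.coeff (k : ℤ)‖ := norm_pos_iff.2 hbk
  have hmk : (0 : ℝ) < ((m + k : ℕ) : ℝ) := by exact_mod_cast (by omega)
  have hK0 : 0 < K := by positivity
  refine ⟨min ε₁ 1, by positivity, fun ε _ hε => ⟨K, hK0, fun w hw => ?_⟩⟩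
  obtain ⟨⟨hwε, hwρ⟩, hcone⟩ := hw
  rw [Metric.mem_ball, dist_eq_norm] at hwε
  have hwε₁ : ‖w - w₀‖ < ε₁ := hwε.trans (hε.trans_le (min_le_left _ _))
  have hw1 : ‖w - w₀‖ < 1 := hwε.trans (hε.trans_le (min_le_right _ _))
  have hne : w ≠ w₀ := by rintro rfl; exact hw₀s hwρ
  have hpos : 0 < ‖w - w₀‖ := norm_pos_iff.2 (sub_ne_zero.2 hne)
  have hroot : ∀ z ∈ symbRoots b m k w, ∃ ζ ∈ symbRoots b m k w₀, z ∈ Metric.ball ζ r :=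
    fun z hz => (hnear w hwε₁ z hz).imp fun ζ h => ⟨h.1, by rw [Metric.mem_ball, dist_eq_norm]; exact h.2⟩
  have hdw : ∀ z ∈ symbRoots b m k w, deriv (symb b) z ≠ 0 := fun z hz => by
    obtain ⟨ζ, hζ, h⟩ := hroot z hz
    exact ((hr ζ hζ).1 z (Metric.ball_subset_ball (by linarith) h)).1
  have hsep : ∀ z ∈ symbRoots b m k w, ∀ y ∈ symbRoots b m k w, z ≠ y → r ≤ ‖z - y‖ := by
    intro z hz y hy hzy
    -- Two roots closer than `r` would lie in one ball of radius `2 r` about a root for `w₀`, where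
    -- the symbol is injective.
    by_contra! hlt
    obtain ⟨ζ, hζ, h⟩ := hroot z hz
    refine hzy (((hr ζ hζ).1 z (Metric.ball_subset_ball (by linarith) h)).2 y ?_ ?_)
    · rw [Metric.mem_ball] at h ⊢
      have := dist_triangle y z ζ
      rw [dist_comm y z, dist_eq_norm z y] at this
      linarith
    · rw [((hmem w z).1 hz).2, ((hmem w y).1 hy).2]
  have hdist : ∀ z ∈ symbRoots b m k w, κ * ‖w - w₀‖ ≤ |‖z‖ - 1| := by
    intro z hz
    obtain ⟨ζ, hζ, h⟩ := hroot z hz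
    have h1 := (hr ζ hζ).2 z h
    rw [((hmem w z).1 hz).2] at h1
    refine h1 hw1.le fun hζ1 => ?_
    exact Set.mem_iInter₂.1 hcone ζ ⟨hζ1, ((hmem w₀ ζ).1 hζ).2⟩
  have hcard := card_symbRoots hm hk hbm hbk hb hdw
  have hT := toeplitzLaurent_sub hb w
  rw [shiftedPoly_eq_prod hm hk hbm hbk hb hdw] at hT
  -- This makes `Ring.inverse` the genuine resolvent rather than its default value `0`.
  have hunit : IsUnit (toeplitzLaurent b - algebraMap ℂ _ w) := by
    rw [← IsUnit.neg_iff, neg_sub]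
    exact hwρ
  rw [hT] at hunit ⊢
  have hmain := norm_inverse_le (S := toeplitzFourier 1) (m := m) (s := symbRoots b m k w)
    star_shift_mul_shift not_isUnit_backshift hbk hm
    (by rw [hcard]; omega) (fun h0 => ((hmem w 0).1 h0).1 rfl) (mul_pos hκ0 hpos)
    (by nlinarith) hr0 hr1.le hdist hsep hunit
  refine hmain.trans ?_
  have hle : Metric.infDist w (spectrum ℂ (toeplitzLaurent b)) ≤ ‖w - w₀‖ := by
    rw [← dist_eq_norm]
    exact Metric.infDist_le_dist_of_mem hw₀s
  -- Needed because division by zero returns `0`, which would spoil the comparison of quotients.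
  have hipos : 0 < Metric.infDist w (spectrum ℂ (toeplitzLaurent b)) := by
    rw [← (isClosed_spectrum (toeplitzLaurent b)).notMem_iff_infDist_pos ⟨w₀, hw₀s⟩]
    exact fun h => h hwρ
  calc _ = K / ‖w - w₀‖ := by
        rw [hcard, hKdef]
        field_simp
    _ ≤ _ := div_le_div_of_nonneg_left hK0.le hipos hle

end HardyToeplitz

theorem mainTheorem2 (m k : ℕ) (hm : 1 ≤ m) (hk : 1 ≤ k) (b : LaurentPolynomial ℂ)
    (hbm : b.coeff (-(m : ℤ)) ≠ 0) (hbk : b.coeff (k : ℤ) ≠ 0)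
    (hb : ∀ n : ℤ, n < -(m : ℤ) ∨ (k : ℤ) < n → b.coeff n = 0)
    (w₀ : ℂ) (hw₀ : w₀ ∈ frontier (spectrum ℂ (HardyToeplitz.toeplitzLaurent b)))
    (hK : w₀ ∉ HardyToeplitz.criticalValues b)
    (c : ℝ) (hc : 0 < c) :
    ∃ ε₀ : ℝ, 0 < ε₀ ∧ ∀ ε : ℝ, 0 < ε → ε < ε₀ → ∃ C : ℝ, 0 < C ∧
      ∀ w ∈ HardyToeplitz.Ω' b c w₀ ε,
        ‖Ring.inverse (HardyToeplitz.toeplitzLaurent b - algebraMap ℂ _ w)‖ ≤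
          C / Metric.infDist w (spectrum ℂ (HardyToeplitz.toeplitzLaurent b)) := by
  exact HardyToeplitz.exists_norm_inverse_sub_le m k hm hk b hbm hbk hb w₀ hw₀ hK c hc
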